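/- Let $n\ge 2$, let $\Delta^n=\{x\in[0,1]^n:\sum_{i=1}^n x_i=1\}$, let $a_1<a_2<\dots<a_n$ be real numbers and let $a_1<E<a_n$. Equip $\Delta^n$ with the Bayesian order $\sqsubseteq$, defined recursively as follows. For $x,y\in\Delta^2$, \[x\sqsubseteq y\iff (y_1\le x_1\le \tfrac12)\ \text{or}\ (\tfrac12\le x_1\le y_1);\] for $x,y\in\Delta^{n+1}$ with $n\ge 2$, $x\sqsubseteq y$ iff $p_i(x)\sqsubseteq p_i(y)$ for every $i$ with $x_i\ne 1$ and $y_i\ne 1$, where $p_i(x)=\frac{1}{1-x_i}(x_1,\dots,\widehat{x_i},\dots,x_{n+1})\in\Delta^n$. This is a partial order with least element $\bot=(1/n,\dots,1/n)$ on $\Delta^n$. For $t\in\mathbb R$ put \[f(t)=\frac{\sum_{i=1}^n a_i e^{ta_i}}{\sum_{i=1}^n e^{ta_i}}-E,\qquad I_f(t)=t-\frac{f(t)}{(a_n-a_1)^2}.\] For $x\in\Delta^n$ let $\mathrm{sort}(x)_1\ge\mathrm{sort}(x)_2$ be its two largest coordinates, counted with multiplicity, and define $\lambda(x)\in\mathbb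 R\cup\{\pm\infty\}$ by \[\lambda(x)=\begin{cases}\dfrac{\log(\mathrm{sort}(x)_1/\mathrm{sort}(x)_2)}{a_n-a_{n-1}}&\text{if }I_f(0)>0,\\[2ex]\dfrac{\log(\mathrm{sort}(x)_1/\mathrm{sort}(x)_2)}{a_1-a_2}&\text{if }I_f(0)\le 0,\end{cases}\] where for a pure state $x$ (one with some $x_i=1$) $\lambda(x)=+\infty$ in the first case and $\lambda(x)=-\infty$ in the second. Define $\phi:\Delta^n\to\Delta^n$ by \[\phi(x)=\frac{1}{Z(x)}\bigl(e^{I_f(\lambda(x))a_1},\dots,e^{I_f(\lambda(x))a_n}\bigr),\qquad Z(x)=\sum_{i=1}^n e^{I_f(\lambda(x))a_i},\] understood as a limit when $x$ is pure: $\phi(x)=e_n$ (the $n$-th unit vector) if $\lambda(x)=+\infty$ and $\phi(x)=e_1$ if $\lambda(x)=-\infty$. Then $\phi$ is Scott continuous in the Bayesian order, that is, it is monotone and preserves suprema of (nonempty) directed sets. Moreover, there is a unique $\lambda\in\mathbb R$ with $E\sum_{i=1}^n e^{\lambda a_i}=\sum_{i=1}^n a_i e^{\lambda a_i}$, and the state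 $y\in\Delta^n$ with \[y_i=\frac{e^{\lambda a_i}}{\sum_{j=1}^n e^{\lambda a_j}}\] is the maximum entropy state, i.e. the unique maximizer of $-\sum_i x_i\log x_i$ (with $0\log 0=0$) over all $x\in\Delta^n$ with $\sum_i a_ix_i=E$; and $y$ is the least fixed point of $\phi$ in the Bayesian order, with $y=\bigsqcup_{k\ge 0}\phi^k(\bot)$. -/

import Mathlib

/-- The classical states `Δⁿ`: probability vectors indexed by `Fin n`. A structure of its own, so that the
pointwise order of functions is not inherited. -/
@[ext]
structure ClassicalState (n : ℕ) where
  prob : Fin n → ℝ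
  mem_stdSimplex : prob ∈ stdSimplex ℝ (Fin n)

namespace ClassicalState

noncomputable section

variable {n m : ℕ}

theorem nonneg (x : ClassicalState n) (i : Fin n) : 0 ≤ x.prob i :=
  x.mem_stdSimplex.1 i

theorem sum_eq (x : ClassicalState n) : ∑ i, x.prob i = 1 :=
  x.mem_stdSimplex.2

theorem le_one (x : ClassicalState n) (i : Fin n) : x.prob i ≤ 1 := by
  rw [← x.sum_eq]
  exact Finset.single_le_sum (fun j _ => x.nonneg j) (Finset.mem_univ i)

theorem sum_succAbove (x : ClassicalState (n + 1)) (i : Fin (n + 1)) :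
    ∑ j, x.prob (i.succAbove j) = 1 - x.prob i := by
  have h := x.sum_eq
  rw [Fin.sum_univ_succAbove _ i] at h
  linarith

theorem add_le_one (x : ClassicalState n) {i j : Fin n} (h : i ≠ j) :
    x.prob i + x.prob j ≤ 1 := by
  rw [← x.sum_eq, ← Finset.sum_pair h]
  exact Finset.sum_le_sum_of_subset_of_nonneg (Finset.subset_univ _) (fun k _ _ => x.nonneg k)

theorem eq_zero_of_one (x : ClassicalState n) {i j : Fin n} (h : i ≠ j) (hi : x.prob i = 1) :
    x.prob j = 0 := by
  have h1 := x.add_le_one h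
  have h2 := x.nonneg j
  linarith

theorem eq_of_one {x y : ClassicalState n} {i : Fin n} (hx : x.prob i = 1) (hy : y.prob i = 1) :
    x = y := by
  ext j
  by_cases h : i = j
  · rw [← h, hx, hy]
  · rw [x.eq_zero_of_one h hx, y.eq_zero_of_one h hy]

/-- A state is pure when one of its coordinates is `1`. -/
def IsPure (x : ClassicalState n) : Prop :=
  ∃ i, x.prob i = 1

/-- The pure state `eᵢ`. -/
def pure (i : Fin n) : ClassicalState n where
  prob := Pi.single i 1
  mem_stdSimplex := single_mem_stdSimplex ℝ i

/-- The uniform state `(1/n, …, 1/n)`. -/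
def uniform (n : ℕ) : ClassicalState (n + 1) where
  prob := fun _ => 1 / ((n : ℝ) + 1)
  mem_stdSimplex := by
    refine ⟨fun i => by positivity, ?_⟩
    rw [Finset.sum_const, Finset.card_univ, Fintype.card_fin, nsmul_eq_mul]
    push_cast
    field_simp

/-- The Bayesian projection `pᵢ`: drop the coordinate `i` and renormalize. Its domain consists of the states
other than `eᵢ`, that is, of those with `xᵢ ≠ 1`. -/
def bayesProj (i : Fin (n + 1)) (x : ClassicalState (n + 1)) (hx : x.prob i ≠ 1) :
    ClassicalState n where
  prob := fun j => x.prob (i.succAbove j) / (1 - x.prob i)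
  mem_stdSimplex := by
    have h : 0 < 1 - x.prob i := sub_pos.2 (lt_of_le_of_ne (x.le_one i) hx)
    refine ⟨fun j => div_nonneg (x.nonneg _) h.le, ?_⟩
    rw [← Finset.sum_div, x.sum_succAbove, div_self h.ne']

/-- The Bayesian order on `Δ^(m+2)`, by recursion on `m`. -/
def BayesLE : (m : ℕ) → ClassicalState (m + 2) → ClassicalState (m + 2) → Prop
  | 0, x, y => (y.prob 0 ≤ x.prob 0 ∧ x.prob 0 ≤ 1 / 2) ∨ (1 / 2 ≤ x.prob 0 ∧ x.prob 0 ≤ y.prob 0)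
  | m + 1, x, y => ∀ (i : Fin (m + 3)) (hx : x.prob i ≠ 1) (hy : y.prob i ≠ 1),
      BayesLE m (bayesProj i x hx) (bayesProj i y hy)

theorem ext_two {x y : ClassicalState 2} (h : x.prob 0 = y.prob 0) : x = y := by
  have hx := x.sum_eq
  have hy := y.sum_eq
  rw [Fin.sum_univ_two] at hx hy
  ext i
  fin_cases i
  · exact h
  · change x.prob 1 = y.prob 1
    linarith

theorem exists_ne_ne (i k : Fin (m + 3)) : ∃ j, j ≠ i ∧ j ≠ k := by
  have h : ({i, k} : Finset (Fin (m + 3))).card < Fintype.card (Fin (m + 3)) := by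
    have := Finset.card_le_two (a := i) (b := k)
    rw [Fintype.card_fin]
    omega
  obtain ⟨j, hj⟩ := Finset.exists_mem_notMem_of_card_lt_card
    (s := {i, k}) (t := Finset.univ) (by rwa [Finset.card_univ])
  exact ⟨j, by simpa using hj⟩

theorem BayesLE.one_of_one : ∀ (m : ℕ) (x y : ClassicalState (m + 2)) (i : Fin (m + 2)),
    BayesLE m x y → x.prob i = 1 → y.prob i = 1
  | 0, x, y, i => by
    intro h hi
    have hx := x.sum_eq
    have hy := y.sum_eq
    rw [Fin.sum_univ_two] at hx hy
    have h0 := y.nonneg 0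
    have h1 := y.nonneg 1
    revert hi
    fin_cases i
    · change x.prob 0 = 1 → y.prob 0 = 1
      intro hi
      rcases h with h | h <;> linarith
    · change x.prob 1 = 1 → y.prob 1 = 1
      intro hi
      rcases h with h | h <;> linarith
  | m + 1, x, y, i => by
    intro h hi
    have key : ∀ k, k ≠ i → y.prob k ≠ 1 → y.prob i = 1 - y.prob k := by
      intro k hk hy
      have hxk : x.prob k = 0 := x.eq_zero_of_one hk.symm hi
      have hx : x.prob k ≠ 1 := by rw [hxk]; exact zero_ne_one
      obtain ⟨j, hj⟩ := Fin.exists_succAbove_eq hk.symm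
      have h1 := BayesLE.one_of_one m _ _ j (h k hx hy)
        (by simp [bayesProj, hj, hi, hxk])
      have h2 : 1 - y.prob k ≠ 0 := sub_ne_zero.2 (Ne.symm hy)
      simp only [bayesProj, hj] at h1
      rwa [div_eq_one_iff_eq h2] at h1
    obtain ⟨j, hj, -⟩ := exists_ne_ne i i
    obtain ⟨k, hki, hkj⟩ := exists_ne_ne i j
    have hij := y.nonneg i
    have hs : y.prob i + y.prob j + y.prob k ≤ 1 := by
      have hsub := Finset.sum_le_sum_of_subset_of_nonneg (f := y.prob)
        (Finset.subset_univ ({i, j, k} : Finset (Fin (m + 3)))) (fun l _ _ => y.nonneg l)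
      rw [y.sum_eq, Finset.sum_insert (by simp [hj.symm, hki.symm]),
        Finset.sum_pair hkj.symm] at hsub
      linarith
    have hj0 := y.nonneg j
    have hk0 := y.nonneg k
    by_cases hyj : y.prob j = 1
    · have := key k hki (by linarith)
      linarith
    · have h1 := key j hj hyj
      have hyk : y.prob k ≠ 1 := by
        intro hyk
        have h2 : y.prob k = 0 := by linarith
        linarith
      have h2 := key k hki hyk
      linarith

theorem BayesLE.eq_of_one {x y : ClassicalState (m + 2)} {i : Fin (m + 2)} (h : BayesLE m x y)
    (hi : x.prob i = 1) : y = x :=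
  ClassicalState.eq_of_one (BayesLE.one_of_one m x y i h hi) hi

theorem BayesLE.refl : ∀ (m : ℕ) (x : ClassicalState (m + 2)), BayesLE m x x
  | 0, x => by
    rcases le_total (x.prob 0) (1 / 2) with h | h
    · exact Or.inl ⟨le_rfl, h⟩
    · exact Or.inr ⟨h, le_rfl⟩
  | m + 1, x => fun i hx _ => BayesLE.refl m (bayesProj i x hx)

theorem BayesLE.trans : ∀ (m : ℕ) (x y z : ClassicalState (m + 2)),
    BayesLE m x y → BayesLE m y z → BayesLE m x z
  | 0, x, y, z => by
    rintro (⟨h1, h2⟩ | ⟨h1, h2⟩) (⟨h3, h4⟩ | ⟨h3, h4⟩)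
    · exact Or.inl ⟨by linarith, h2⟩
    · exact Or.inr ⟨by linarith, by linarith⟩
    · exact Or.inl ⟨by linarith, by linarith⟩
    · exact Or.inr ⟨h1, by linarith⟩
  | m + 1, x, y, z => by
    intro hxy hyz i hx hz
    by_cases hy : y.prob i = 1
    · exact absurd (BayesLE.one_of_one _ y z i hyz hy) hz
    · exact BayesLE.trans m _ _ _ (hxy i hx hy) (hyz i hy hz)

theorem BayesLE.antisymm : ∀ (m : ℕ) (x y : ClassicalState (m + 2)),
    BayesLE m x y → BayesLE m y x → x = y
  | 0, x, y => by
    intro h1 h2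
    apply ext_two
    rcases h1 with ⟨h1, h3⟩ | ⟨h1, h3⟩ <;> rcases h2 with ⟨h2, h4⟩ | ⟨h2, h4⟩ <;> linarith
  | m + 1, x, y => by
    intro h1 h2
    by_cases hx : ∃ i, x.prob i = 1
    · obtain ⟨i, hi⟩ := hx
      exact (h1.eq_of_one hi).symm
    by_cases hy : ∃ i, y.prob i = 1
    · obtain ⟨i, hi⟩ := hy
      exact h2.eq_of_one hi
    push Not at hx hy
    have key : ∀ i j, j ≠ i → x.prob j * (1 - y.prob i) = y.prob j * (1 - x.prob i) := by
      intro i j hij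
      have h := BayesLE.antisymm m _ _ (h1 i (hx i) (hy i)) (h2 i (hy i) (hx i))
      obtain ⟨k, hk⟩ := Fin.exists_succAbove_eq hij
      have h' := congrArg (fun s => s.prob k) h
      simp only [bayesProj, hk] at h'
      rwa [div_eq_div_iff (sub_ne_zero.2 (hx i).symm) (sub_ne_zero.2 (hy i).symm)] at h'
    have neg : ∀ i j, j ≠ i → x.prob j - y.prob j = -(x.prob i - y.prob i) := by
      intro i j hij
      have e1 := key i j hij
      have e2 := key j i hij.symm
      linarith
    ext i
    obtain ⟨j, hj, -⟩ := exists_ne_ne i i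
    obtain ⟨k, hki, hkj⟩ := exists_ne_ne i j
    have e1 := neg i j hj
    have e2 := neg i k hki
    have e3 := neg j k hkj
    linarith

/-- `Δ^(m+2)` with the Bayesian order. -/
instance : PartialOrder (ClassicalState (m + 2)) where
  le := BayesLE m
  le_refl := BayesLE.refl m
  le_trans := BayesLE.trans m
  le_antisymm := BayesLE.antisymm m

theorem uniform_bayesLE : ∀ (m : ℕ) (x : ClassicalState (m + 2)), BayesLE m (uniform (m + 1)) x
  | 0, x => by
    have h : (uniform 1).prob 0 = 1 / 2 := by simp only [uniform]; norm_num
    rcases le_total (x.prob 0) (1 / 2) with h1 | h1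
    · exact Or.inl ⟨by rw [h]; exact h1, h.le⟩
    · exact Or.inr ⟨h.ge, by rw [h]; exact h1⟩
  | m + 1, x => by
    intro i hx hy
    have h : bayesProj i (uniform (m + 2)) hx = uniform (m + 1) := by
      ext j
      simp only [bayesProj, uniform]
      push_cast
      have h1 : (m : ℝ) + 2 + 1 ≠ 0 := by positivity
      have h2 : (m : ℝ) + 1 + 1 ≠ 0 := by positivity
      rw [one_sub_div h1, div_div_div_cancel_right₀ h1]
      congr 1
      ring
    rw [h]
    exact uniform_bayesLE m _

/-- The least element `⊥` of the Bayesian order is the uniform state. -/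
instance : OrderBot (ClassicalState (m + 2)) where
  bot := uniform (m + 1)
  bot_le := uniform_bayesLE m

/-- The average value `⟨a|x⟩ = ∑ᵢ aᵢ xᵢ` of the observable `a`. -/
def average (a : Fin n → ℝ) (x : ClassicalState n) : ℝ :=
  ∑ i, a i * x.prob i

/-- Shannon entropy `σ x = -∑ᵢ xᵢ log xᵢ`, with `0 log 0 = 0`. -/
def entropy (x : ClassicalState n) : ℝ :=
  -∑ i, x.prob i * Real.log (x.prob i)

/-- `y` maximizes the entropy among the states at which the observable `a` has the average value `E`. -/
def IsMaxEntropy (a : Fin n → ℝ) (E : ℝ) (y : ClassicalState n) : Prop :=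
  average a y = E ∧ ∀ x : ClassicalState n, average a x = E → entropy x ≤ entropy y

/-- The state with coordinates `exp (t aᵢ) / ∑ⱼ exp (t aⱼ)`. -/
def gibbs (a : Fin (m + 2) → ℝ) (t : ℝ) : ClassicalState (m + 2) where
  prob := fun i => Real.exp (t * a i) / ∑ j, Real.exp (t * a j)
  mem_stdSimplex := by
    have h : 0 < ∑ j, Real.exp (t * a j) :=
      Finset.sum_pos (fun j _ => Real.exp_pos _) Finset.univ_nonempty
    refine ⟨fun i => div_nonneg (Real.exp_pos _).le h.le, ?_⟩
    rw [← Finset.sum_div, div_self h.ne']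

/-- `f(t) = (∑ᵢ aᵢ exp (t aᵢ)) / (∑ᵢ exp (t aᵢ)) - E`. -/
def gap (a : Fin (m + 2) → ℝ) (E t : ℝ) : ℝ :=
  (∑ i, a i * Real.exp (t * a i)) / (∑ i, Real.exp (t * a i)) - E

/-- `I_f(t) = t - f(t) / (a_n - a_1)²`. -/
def iter (a : Fin (m + 2) → ℝ) (E t : ℝ) : ℝ :=
  t - gap a E t / (a (Fin.last (m + 1)) - a 0) ^ 2

/-- The coordinates of `x` in decreasing order. -/
def sortDesc (x : ClassicalState n) : Fin n → ℝ :=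
  x.prob ∘ Tuple.sort (fun i => -x.prob i)

theorem sortDesc_antitone (x : ClassicalState n) : Antitone x.sortDesc := by
  intro i j hij
  have h := Tuple.monotone_sort (fun i => -x.prob i) hij
  exact neg_le_neg_iff.1 h

open scoped Classical in
/-- The function `λ : Δⁿ → ℝ ∪ {±∞}`, where `n = m + 2`: the quotient of `log (sort(x)₁ / sort(x)₂)` by
`a_n - a_{n-1}` if `I_f(0) > 0` and by `a_1 - a_2` otherwise; for pure states it is `∞` in the first case and
`-∞` in the second. -/
def lam (a : Fin (m + 2) → ℝ) (E : ℝ) (x : ClassicalState (m + 2)) : EReal :=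
  if 0 < iter a E 0 then
    if x.IsPure then ⊤
    else ((Real.log (x.sortDesc 0 / x.sortDesc 1) /
      (a (Fin.last (m + 1)) - a (Fin.last m).castSucc) : ℝ) : EReal)
  else
    if x.IsPure then ⊥
    else ((Real.log (x.sortDesc 0 / x.sortDesc 1) / (a 0 - a 1) : ℝ) : EReal)

/-- The state with coordinates `exp (I_f(s) aᵢ) / ∑ⱼ exp (I_f(s) aⱼ)`; at `s = ±∞` it is the limit, which is
`e_n` at `∞` and `e_1` at `-∞`. -/
def gibbsIter (a : Fin (m + 2) → ℝ) (E : ℝ) : EReal → ClassicalState (m + 2)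
  | ⊥ => pure 0
  | ⊤ => pure (Fin.last (m + 1))
  | (t : ℝ) => gibbs a (iter a E t)

/-- The map `φ(x) = (exp (I_f(λ x) aᵢ) / Z(x))ᵢ`. -/
def phi (a : Fin (m + 2) → ℝ) (E : ℝ) (x : ClassicalState (m + 2)) : ClassicalState (m + 2) :=
  gibbsIter a E (lam a E x)

end

end ClassicalState

/-! The recursion in the Bayesian order unwinds to a pairwise condition (`le_iff_compat`): any two
coordinates are ordered the same way in both states, and the ratio of larger to smaller does not
decrease, read after cross-multiplication. This condition is closed, so compactness of the simplex
turns a directed supremum into a coordinatewise limit along an ultrafilter.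

The map `phi` sees a state only through the ratio of its two largest coordinates. On the Gibbs state
with parameter `t` on the side of `0` selected by the sign of `I_f(0)`, `lam` recovers `t`, so there
`phi` acts as `I_f` on the parameter (`phi_gibbs`). Since `f'` is the variance of `a`, it lies
strictly above `0` and at most at `(a_n - a_1)²`: `f` has one zero `l`, and `I_f` is monotone with
`l` as its only fixed point. The iterates of `I_f` from `0` therefore converge monotonically to `l`.

Monotonicity of `phi` combines a common top pair for `x ≤ y` with monotonicity of `I_f`. Scott
continuity follows from continuity along the ultrafilter, including the limit at pure states. The
Gibbs inequality shows that the state at `l` maximizes entropy. -/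

namespace ClassicalState

open Filter Topology

variable {n m : ℕ}

/-! ### The Bayesian order without recursion -/

/-- The coordinates `i` and `j` are ordered in the same way in `x` and in `y`, with `i` above `j`, and their
ratio does not decrease from `x` to `y`. -/
def Compat (x y : Fin n → ℝ) (i j : Fin n) : Prop :=
  x j ≤ x i ∧ y j ≤ y i ∧ x i * y j ≤ x j * y i

theorem Compat.smul {x y : Fin n → ℝ} {i j : Fin n} (h : Compat x y i j) {r s : ℝ} (hr : 0 ≤ r)
    (hs : 0 ≤ s) : Compat (fun k => r * x k) (fun k => s * y k) i j := by
  obtain ⟨h1, h2, h3⟩ := h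
  refine ⟨mul_le_mul_of_nonneg_left h1 hr, mul_le_mul_of_nonneg_left h2 hs, ?_⟩
  have := mul_le_mul_of_nonneg_left h3 (mul_nonneg hr hs)
  change r * x i * (s * y j) ≤ r * x j * (s * y i)
  linarith

/-- Compatibility is homogeneous in each state, hence survives deletion of a coordinate and
renormalization. On `Δ²` the ratio inequality reduces to comparing single coordinates. -/
theorem bayesLE_of_compat : ∀ (m : ℕ) (x y : ClassicalState (m + 2)),
    (∀ i j, Compat x.prob y.prob i j ∨ Compat x.prob y.prob j i) → BayesLE m x y
  | 0, x, y => by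
    intro h
    have hx := x.sum_eq
    have hy := y.sum_eq
    rw [Fin.sum_univ_two] at hx hy
    have ex : x.prob 1 = 1 - x.prob 0 := by linarith
    have ey : y.prob 1 = 1 - y.prob 0 := by linarith
    rcases h 0 1 with ⟨h1, h2, h3⟩ | ⟨h1, h2, h3⟩ <;> rw [ex] at h1 h3 <;> rw [ey] at h2 h3
    · exact Or.inr ⟨by linarith, by linarith⟩
    · exact Or.inl ⟨by linarith, by linarith⟩
  | m + 1, x, y => by
    intro h i hx hy
    refine bayesLE_of_compat m _ _ fun j k => ?_
    have hx' : 0 ≤ (1 - x.prob i)⁻¹ := inv_nonneg.2 (sub_nonneg.2 (x.le_one i))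
    have hy' : 0 ≤ (1 - y.prob i)⁻¹ := inv_nonneg.2 (sub_nonneg.2 (y.le_one i))
    have key : ∀ j k, Compat x.prob y.prob (i.succAbove j) (i.succAbove k) →
        Compat (bayesProj i x hx).prob (bayesProj i y hy).prob j k := by
      intro j k hjk
      have := hjk.smul hx' hy'
      simpa only [Compat, bayesProj, div_eq_inv_mul] using this
    exact (h _ _).imp (key j k) (key k j)

/-- With at least three coordinates, a pair `j`, `k` survives dropping some third `i`. The
projection is undefined in two cases only: `x i = 1` forces `y = x`, and `y i = 1` makes both `y j`
and `y k` vanish. -/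
theorem BayesLE.compat : ∀ (m : ℕ) (x y : ClassicalState (m + 2)), BayesLE m x y →
    ∀ i j, Compat x.prob y.prob i j ∨ Compat x.prob y.prob j i
  | 0, x, y => by
    intro h
    have hx := x.sum_eq
    have hy := y.sum_eq
    rw [Fin.sum_univ_two] at hx hy
    have ex : x.prob 1 = 1 - x.prob 0 := by linarith
    have ey : y.prob 1 = 1 - y.prob 0 := by linarith
    have key : Compat x.prob y.prob 0 1 ∨ Compat x.prob y.prob 1 0 := by
      simp only [Compat, ex, ey]
      rcases h with ⟨h1, h2⟩ | ⟨h1, h2⟩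
      · exact Or.inr ⟨by linarith, by linarith, by linarith⟩
      · exact Or.inl ⟨by linarith, by linarith, by linarith⟩
    intro i j
    by_cases hij : i = j
    · subst hij
      exact Or.inl ⟨le_rfl, le_rfl, le_rfl⟩
    fin_cases i <;> fin_cases j
    · exact absurd rfl hij
    · exact key
    · exact key.symm
    · exact absurd rfl hij
  | m + 1, x, y => by
    intro h j k
    by_cases hjk : j = k
    · subst hjk
      exact Or.inl ⟨le_rfl, le_rfl, le_rfl⟩
    obtain ⟨i, hij, hik⟩ := exists_ne_ne j k
    by_cases hx : x.prob i = 1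
    · rw [BayesLE.eq_of_one h hx]
      rcases le_total (x.prob k) (x.prob j) with h1 | h1
      · exact Or.inl ⟨h1, h1, (mul_comm _ _).le⟩
      · exact Or.inr ⟨h1, h1, (mul_comm _ _).le⟩
    by_cases hy : y.prob i = 1
    · have e1 := y.eq_zero_of_one hij hy
      have e2 := y.eq_zero_of_one hik hy
      simp only [Compat, e1, e2, mul_zero, le_refl, and_true]
      exact le_total _ _
    have hx' : 0 < 1 - x.prob i := sub_pos.2 (lt_of_le_of_ne (x.le_one i) hx)
    have hy' : 0 < 1 - y.prob i := sub_pos.2 (lt_of_le_of_ne (y.le_one i) hy)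
    obtain ⟨j', hj⟩ := Fin.exists_succAbove_eq hij.symm
    obtain ⟨k', hk⟩ := Fin.exists_succAbove_eq hik.symm
    have key : ∀ j' k', Compat (bayesProj i x hx).prob (bayesProj i y hy).prob j' k' →
        Compat x.prob y.prob (i.succAbove j') (i.succAbove k') := by
      intro j' k' h'
      have := h'.smul hx'.le hy'.le
      simpa only [Compat, bayesProj, mul_div_cancel₀ _ hx'.ne', mul_div_cancel₀ _ hy'.ne']
        using this
    rw [← hj, ← hk]
    exact (BayesLE.compat m _ _ (h i hx hy) j' k').imp (key _ _) (key _ _)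

/-- A description of the Bayesian order without recursion. -/
theorem le_iff_compat {x y : ClassicalState (m + 2)} :
    x ≤ y ↔ ∀ i j, Compat x.prob y.prob i j ∨ Compat x.prob y.prob j i :=
  ⟨BayesLE.compat m x y, bayesLE_of_compat m x y⟩

theorem Compat.isClosed (i j : Fin n) :
    IsClosed {p : (Fin n → ℝ) × (Fin n → ℝ) | Compat p.1 p.2 i j} := by
  have h1 : IsClosed {p : (Fin n → ℝ) × (Fin n → ℝ) | p.1 j ≤ p.1 i} :=
    isClosed_le (by fun_prop) (by fun_prop)
  have h2 : IsClosed {p : (Fin n → ℝ) × (Fin n → ℝ) | p.2 j ≤ p.2 i} :=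
    isClosed_le (by fun_prop) (by fun_prop)
  have h3 : IsClosed {p : (Fin n → ℝ) × (Fin n → ℝ) | p.1 i * p.2 j ≤ p.1 j * p.2 i} :=
    isClosed_le (by fun_prop) (by fun_prop)
  exact h1.inter (h2.inter h3)

/-- The Bayesian order is closed under coordinatewise limits. -/
theorem le_of_tendsto_prob {ι : Type*} {F : Filter ι} [NeBot F] {u v : ι → ClassicalState (m + 2)}
    {x y : ClassicalState (m + 2)} (hu : Tendsto (fun t => (u t).prob) F (𝓝 x.prob))
    (hv : Tendsto (fun t => (v t).prob) F (𝓝 y.prob)) (h : ∀ᶠ t in F, u t ≤ v t) : x ≤ y := by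
  refine le_iff_compat.2 fun i j => ?_
  have hc : IsClosed {p : (Fin (m + 2) → ℝ) × (Fin (m + 2) → ℝ) |
      Compat p.1 p.2 i j ∨ Compat p.1 p.2 j i} := (Compat.isClosed i j).union (Compat.isClosed j i)
  exact hc.mem_of_tendsto (hu.prodMk_nhds hv) (h.mono fun t ht => le_iff_compat.1 ht i j)

/-! ### The two largest coordinates -/

/-- `i` and `j` carry the two largest coordinates of `x`. -/
structure IsTopPair (x : Fin n → ℝ) (i j : Fin n) : Prop where
  ne : i ≠ j
  le_fst : ∀ k, x k ≤ x i
  le_snd : ∀ k, k ≠ i → x k ≤ x j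

/-- Comparable states order each pair of coordinates alike, so ranking by the sum `x + y` ranks both
states at once; the top two indices of the sum serve for both. -/
theorem exists_isTopPair_of_le {x y : ClassicalState (m + 2)} (h : x ≤ y) :
    ∃ i j, IsTopPair x.prob i j ∧ IsTopPair y.prob i j ∧
      x.prob i * y.prob j ≤ x.prob j * y.prob i := by
  have h' := le_iff_compat.1 h
  have key : ∀ i k, x.prob k + y.prob k ≤ x.prob i + y.prob i →
      x.prob k ≤ x.prob i ∧ y.prob k ≤ y.prob i ∧
        x.prob i * y.prob k ≤ x.prob k * y.prob i := by
    intro i k hk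
    rcases h' i k with h1 | ⟨h1, h2, -⟩
    · exact h1
    · have e1 : x.prob k = x.prob i := by linarith
      have e2 : y.prob k = y.prob i := by linarith
      exact ⟨e1.le, e2.le, by rw [e1, e2]⟩
  obtain ⟨i, -, hi⟩ := Finset.exists_max_image Finset.univ (fun k => x.prob k + y.prob k)
    Finset.univ_nonempty
  have hne : (Finset.univ.erase i).Nonempty := by
    rw [← Finset.card_pos, Finset.card_erase_of_mem (Finset.mem_univ i)]
    simp
  obtain ⟨j, hj', hj⟩ := Finset.exists_max_image _ (fun k => x.prob k + y.prob k) hne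
  have hji := Finset.ne_of_mem_erase hj'
  have hk : ∀ k, k ≠ i → x.prob k + y.prob k ≤ x.prob j + y.prob j := fun k hk =>
    hj k (Finset.mem_erase.2 ⟨hk, Finset.mem_univ k⟩)
  exact ⟨i, j,
    ⟨hji.symm, fun k => (key i k (hi k (Finset.mem_univ k))).1, fun k h => (key j k (hk k h)).1⟩,
    ⟨hji.symm, fun k => (key i k (hi k (Finset.mem_univ k))).2.1,
      fun k h => (key j k (hk k h)).2.1⟩,
    (key i j (hi j (Finset.mem_univ j))).2.2⟩

theorem exists_isTopPair (x : ClassicalState (m + 2)) : ∃ i j, IsTopPair x.prob i j := by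
  obtain ⟨i, j, h, -⟩ := exists_isTopPair_of_le (le_refl x)
  exact ⟨i, j, h⟩

namespace IsTopPair

theorem sortDesc_zero {x : ClassicalState (m + 2)} {i j : Fin (m + 2)} (h : IsTopPair x.prob i j) :
    x.sortDesc 0 = x.prob i := by
  refine le_antisymm (h.le_fst _) ?_
  have := x.sortDesc_antitone (Fin.zero_le ((Tuple.sort fun i => -x.prob i).symm i))
  simpa [sortDesc] using this

theorem sortDesc_one {x : ClassicalState (m + 2)} {i j : Fin (m + 2)} (h : IsTopPair x.prob i j) :
    x.sortDesc 1 = x.prob j := by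
  set σ := Tuple.sort fun i => -x.prob i with hσ
  have hd : ∀ k, x.sortDesc k = x.prob (σ k) := fun k => rfl
  have hle : ∀ k, σ.symm k ≠ 0 → x.prob k ≤ x.sortDesc 1 := by
    intro k hk
    have := x.sortDesc_antitone (Fin.one_le_of_ne_zero hk)
    simpa [hd] using this
  apply le_antisymm
  · by_cases h1 : σ 1 = i
    · have h0 : σ 0 ≠ i := by
        rw [← h1]
        exact σ.injective.ne zero_ne_one
      exact (x.sortDesc_antitone (Fin.zero_le 1)).trans (h.le_snd _ h0)
    · exact h.le_snd _ h1
  · by_cases h0 : σ.symm j = 0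
    · refine (h.le_fst j).trans (hle i fun h1 => h.ne ?_)
      exact σ.symm.injective (h1.trans h0.symm)
    · exact hle j h0

theorem isPure_iff {x : ClassicalState (m + 2)} {i j : Fin (m + 2)} (h : IsTopPair x.prob i j) :
    x.IsPure ↔ x.prob j = 0 := by
  constructor
  · rintro ⟨k, hk⟩
    by_cases hkj : k = j
    · subst hkj
      have h1 := h.le_fst k
      have h2 := x.add_le_one h.ne
      linarith
    · exact x.eq_zero_of_one hkj hk
  · intro hj
    refine ⟨i, ?_⟩
    rw [← x.sum_eq]
    refine (Finset.sum_eq_single i (fun k _ hk => ?_) (by simp)).symm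
    exact le_antisymm (hj ▸ h.le_snd k hk) (x.nonneg k)

theorem snd_pos {x : ClassicalState (m + 2)} {i j : Fin (m + 2)} (h : IsTopPair x.prob i j)
    (hx : ¬ x.IsPure) : 0 < x.prob j :=
  lt_of_le_of_ne (x.nonneg j) fun h0 => hx (h.isPure_iff.2 h0.symm)

theorem one_le_div {x : ClassicalState (m + 2)} {i j : Fin (m + 2)} (h : IsTopPair x.prob i j)
    (hx : ¬ x.IsPure) : 1 ≤ x.prob i / x.prob j :=
  (one_le_div₀ (h.snd_pos hx)).2 (h.le_fst j)

theorem isClosed (i j : Fin n) : IsClosed {x : Fin n → ℝ | IsTopPair x i j} := by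
  have : {x : Fin n → ℝ | IsTopPair x i j} = {_x | i ≠ j} ∩ ({x | ∀ k, x k ≤ x i} ∩
      {x | ∀ k, k ≠ i → x k ≤ x j}) := by
    ext x
    exact ⟨fun h => ⟨h.ne, h.le_fst, h.le_snd⟩, fun h => ⟨h.1, h.2.1, h.2.2⟩⟩
  rw [this]
  refine isClosed_const.inter (IsClosed.inter ?_ ?_)
  · simp only [Set.ofPred_forall]
    exact isClosed_iInter fun k => isClosed_le (by fun_prop) (by fun_prop)
  · simp only [Set.ofPred_forall]
    exact isClosed_iInter fun k => isClosed_iInter fun _ => isClosed_le (by fun_prop) (by fun_prop)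

end IsTopPair

/-! ### Directed suprema as limits -/

theorem IsPure.mono {x y : ClassicalState (m + 2)} (h : x ≤ y) (hx : x.IsPure) : y = x := by
  obtain ⟨i, hi⟩ := hx
  exact BayesLE.eq_of_one h hi

/-- Along a suitable ultrafilter, the elements of a directed set converge to its supremum. -/
theorem exists_ultrafilter_tendsto {D : Set (ClassicalState (m + 2))} (hne : D.Nonempty)
    (hD : DirectedOn (· ≤ ·) D) {y : ClassicalState (m + 2)} (hy : IsLUB D y) :
    ∃ U : Ultrafilter D, Tendsto (fun d : D => d.1.prob) U (𝓝 y.prob) := by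
  have : Nonempty D := hne.to_subtype
  have : IsDirectedOrder D := ⟨directedOn_iff_directed.1 hD⟩
  let U : Ultrafilter D := Ultrafilter.of atTop
  have hU : (U : Filter D) ≤ atTop := Ultrafilter.of_le _
  obtain ⟨z, hz, hUz⟩ := (isCompact_stdSimplex ℝ (Fin (m + 2))).ultrafilter_le_nhds
    (U.map fun d : D => d.1.prob)
    (by
      rw [le_principal_iff]
      exact Filter.mem_map.2 (Filter.Eventually.of_forall fun d => d.1.mem_stdSimplex))
  have hlim : Tendsto (fun d : D => d.1.prob) U (𝓝 z) := hUz
  -- The limit is itself a supremum: each element of `D` is eventually below the net, every upper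
  -- bound is above it, and the order is closed.
  have hzl : IsLUB D (⟨z, hz⟩ : ClassicalState (m + 2)) := by
    constructor
    · intro d hd
      refine le_of_tendsto_prob (F := (U : Filter D)) (u := fun _ => d) (v := fun e => e.1)
        tendsto_const_nhds hlim ?_
      exact hU (eventually_ge_atTop (⟨d, hd⟩ : D))
    · intro w hw
      exact le_of_tendsto_prob (F := (U : Filter D)) (u := fun e => e.1) (v := fun _ => w)
        hlim tendsto_const_nhds (Eventually.of_forall fun e => hw e.2)
  rw [hy.unique hzl]
  exact ⟨U, hlim⟩

/-- There are finitely many index pairs, so an ultrafilter settles on one; being a top pair is a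
closed condition and passes to the limit. -/
theorem exists_eventually_isTopPair {ι : Type*} (U : Ultrafilter ι) {u : ι → ClassicalState (m + 2)}
    {x : ClassicalState (m + 2)} (hu : Tendsto (fun t => (u t).prob) U (𝓝 x.prob)) :
    ∃ i j, (∀ᶠ t in (U : Filter ι), IsTopPair (u t).prob i j) ∧ IsTopPair x.prob i j := by
  have h : ∀ᶠ t in (U : Filter ι), ∃ p ∈ (Set.univ : Set (Fin (m + 2) × Fin (m + 2))),
      IsTopPair (u t).prob p.1 p.2 := by
    refine Eventually.of_forall fun t => ?_
    obtain ⟨i, j, h⟩ := exists_isTopPair (u t)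
    exact ⟨(i, j), Set.mem_univ _, h⟩
  obtain ⟨⟨i, j⟩, -, hp⟩ := (Ultrafilter.eventually_exists_mem_iff Set.finite_univ).1 h
  exact ⟨i, j, hp, (IsTopPair.isClosed i j).mem_of_tendsto hu hp⟩

/-! ### Gibbs states, mean energy and the iteration `I_f` -/

section Gibbs

variable (a : Fin (m + 2) → ℝ) (E : ℝ)

theorem partition_pos (t : ℝ) : 0 < ∑ j, Real.exp (t * a j) :=
  Finset.sum_pos (fun _ _ => Real.exp_pos _) Finset.univ_nonempty

theorem gibbs_pos (t : ℝ) (i : Fin (m + 2)) : 0 < (gibbs a t).prob i :=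
  div_pos (Real.exp_pos _) (partition_pos a t)

theorem gap_eq_average (t : ℝ) : gap a E t = average a (gibbs a t) - E := by
  simp only [gap, average, gibbs, Finset.sum_div, mul_div_assoc]

theorem gap_eq_zero_iff (t : ℝ) :
    gap a E t = 0 ↔ E * ∑ i, Real.exp (t * a i) = ∑ i, a i * Real.exp (t * a i) := by
  rw [gap, sub_eq_zero, div_eq_iff (partition_pos a t).ne', eq_comm]

theorem average_le {x : ClassicalState n} {a : Fin n → ℝ} {b : ℝ} (h : ∀ i, a i ≤ b) :
    average a x ≤ b := by
  have : ∑ i, a i * x.prob i ≤ ∑ i, b * x.prob i :=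
    Finset.sum_le_sum fun i _ => mul_le_mul_of_nonneg_right (h i) (x.nonneg i)
  rwa [← Finset.mul_sum, x.sum_eq, mul_one] at this

theorem le_average {x : ClassicalState n} {a : Fin n → ℝ} {b : ℝ} (h : ∀ i, b ≤ a i) :
    b ≤ average a x := by
  have : ∑ i, b * x.prob i ≤ ∑ i, a i * x.prob i :=
    Finset.sum_le_sum fun i _ => mul_le_mul_of_nonneg_right (h i) (x.nonneg i)
  rwa [← Finset.mul_sum, x.sum_eq, mul_one] at this

/-- The derivative of the mean energy is the variance of the energy. -/
theorem hasDerivAt_gap (t : ℝ) :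
    HasDerivAt (gap a E)
      (∑ i, (a i - average a (gibbs a t)) ^ 2 * (gibbs a t).prob i) t := by
  have hexp : ∀ i, HasDerivAt (fun t => Real.exp (t * a i)) (a i * Real.exp (t * a i)) t := by
    intro i
    have := ((hasDerivAt_id t).mul_const (a i)).exp
    simpa [mul_comm] using this
  have hZ : HasDerivAt (fun t => ∑ i, Real.exp (t * a i)) (∑ i, a i * Real.exp (t * a i)) t :=
    HasDerivAt.fun_sum fun i _ => hexp i
  have hN : HasDerivAt (fun t => ∑ i, a i * Real.exp (t * a i))
      (∑ i, a i * (a i * Real.exp (t * a i))) t :=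
    HasDerivAt.fun_sum fun i _ => (hexp i).const_mul (a i)
  have hpos := partition_pos a t
  have h : HasDerivAt (gap a E) _ t := (hN.div hZ hpos.ne').sub_const E
  refine h.congr_deriv ?_
  symm
  set p := (gibbs a t).prob with hp
  set μ := average a (gibbs a t) with hμ
  set Z := ∑ j, Real.exp (t * a j) with hZ'
  have hw : ∀ i, Real.exp (t * a i) = Z * p i := by
    intro i
    rw [hp, gibbs]
    exact (mul_div_cancel₀ _ hpos.ne').symm
  have e1 : ∑ i, a i * Real.exp (t * a i) = Z * μ := by
    rw [hμ, average, Finset.mul_sum]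
    exact Finset.sum_congr rfl fun i _ => by rw [hw]; ring
  have e2 : ∑ i, a i * (a i * Real.exp (t * a i)) = Z * ∑ i, a i ^ 2 * p i := by
    rw [Finset.mul_sum]
    exact Finset.sum_congr rfl fun i _ => by rw [hw]; ring
  have e3 : ∑ i, (a i - μ) ^ 2 * p i = ∑ i, a i ^ 2 * p i - μ ^ 2 := by
    have : ∀ i, (a i - μ) ^ 2 * p i = a i ^ 2 * p i - 2 * μ * (a i * p i) + μ ^ 2 * p i :=
      fun i => by ring
    have hs : ∑ i, p i = 1 := (gibbs a t).sum_eq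
    have hm : ∑ i, a i * p i = μ := rfl
    rw [Finset.sum_congr rfl fun i _ => this i, Finset.sum_add_distrib, Finset.sum_sub_distrib,
      ← Finset.mul_sum, ← Finset.mul_sum, hs, hm]
    ring
  rw [e1, e2, e3]
  field_simp

theorem continuous_gap : Continuous (gap a E) :=
  continuous_iff_continuousAt.2 fun t => (hasDerivAt_gap a E t).continuousAt

theorem continuous_iter : Continuous (iter a E) :=
  continuous_id.sub ((continuous_gap a E).div_const _)

theorem continuous_gibbs_prob : Continuous fun t => (gibbs a t).prob := by
  refine continuous_pi fun i => ?_
  refine Continuous.div (by fun_prop) (by fun_prop) fun t => (partition_pos a t).ne'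

/-- The Gibbs states concentrate at the index of the dominant exponent. -/
theorem tendsto_gibbs_pure {ι : Type*} {F : Filter ι} {s : ι → ℝ} {k : Fin (m + 2)}
    (h : ∀ i, i ≠ k → Tendsto (fun t => s t * (a i - a k)) F atBot) :
    Tendsto (fun t => (gibbs a (s t)).prob) F (𝓝 (pure k).prob) := by
  have h0 : ∀ i, i ≠ k → Tendsto (fun t => (gibbs a (s t)).prob i) F (𝓝 0) := by
    intro i hi
    refine squeeze_zero (fun t => (gibbs a (s t)).nonneg i) (fun t => ?_)
      (Real.tendsto_exp_atBot.comp (h i hi))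
    change Real.exp (s t * a i) / _ ≤ Real.exp (s t * (a i - a k))
    rw [mul_sub, Real.exp_sub]
    refine div_le_div_of_nonneg_left (Real.exp_pos _).le (Real.exp_pos _) ?_
    exact Finset.single_le_sum (f := fun j => Real.exp (s t * a j))
      (fun j _ => (Real.exp_pos _).le) (Finset.mem_univ k)
  refine tendsto_pi_nhds.2 fun i => ?_
  by_cases hi : i = k
  · subst hi
    have e : ∀ t, (gibbs a (s t)).prob i = 1 - ∑ j ∈ Finset.univ.erase i, (gibbs a (s t)).prob j := by
      intro t
      rw [← (gibbs a (s t)).sum_eq, ← Finset.add_sum_erase _ _ (Finset.mem_univ i)]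
      ring
    have h1 : Tendsto (fun t => 1 - ∑ j ∈ Finset.univ.erase i, (gibbs a (s t)).prob j) F
        (𝓝 (1 - ∑ j ∈ Finset.univ.erase i, 0)) :=
      tendsto_const_nhds.sub (tendsto_finsetSum _ fun j hj => h0 j (Finset.ne_of_mem_erase hj))
    have e1 : (pure i).prob i = 1 - ∑ j ∈ Finset.univ.erase i, (0 : ℝ) := by simp [pure]
    rw [e1]
    exact h1.congr fun t => (e t).symm
  · simpa [pure, hi] using h0 i hi

theorem average_pure (k : Fin n) (a : Fin n → ℝ) : average a (pure k) = a k := by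
  simp [average, pure, Pi.single_apply]

theorem tendsto_average {ι : Type*} {F : Filter ι} {u : ι → ClassicalState n} {x : ClassicalState n}
    {a : Fin n → ℝ} (h : Tendsto (fun t => (u t).prob) F (𝓝 x.prob)) :
    Tendsto (fun t => average a (u t)) F (𝓝 (average a x)) :=
  tendsto_finsetSum _ fun i _ => (tendsto_pi_nhds.1 h i).const_mul (a i)

variable {a} {E}

/-- The variance is positive because every Gibbs weight is positive and `a` is not constant. -/
theorem strictMono_gap (ha : StrictMono a) : StrictMono (gap a E) := by
  refine strictMono_of_deriv_pos fun t => ?_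
  rw [(hasDerivAt_gap a E t).deriv]
  have hne : ∃ i, a i ≠ average a (gibbs a t) := by
    by_contra! h
    exact zero_ne_one (ha.injective ((h 0).trans (h 1).symm))
  obtain ⟨i, hi⟩ := hne
  refine Finset.sum_pos' (fun j _ => mul_nonneg (sq_nonneg _) ((gibbs a t).nonneg j))
    ⟨i, Finset.mem_univ i, mul_pos (sq_pos_of_ne_zero (sub_ne_zero.2 hi)) (gibbs_pos a t i)⟩

theorem le_last (ha : StrictMono a) (i : Fin (m + 2)) : a i ≤ a (Fin.last (m + 1)) :=
  ha.monotone (Fin.le_last i)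

theorem zero_le (ha : StrictMono a) (i : Fin (m + 2)) : a 0 ≤ a i :=
  ha.monotone (Fin.zero_le i)

theorem spread_pos (ha : StrictMono a) : 0 < a (Fin.last (m + 1)) - a 0 :=
  sub_pos.2 (ha (Fin.last_pos))

/-- The mean lies between `a_1` and `a_n`, so the variance is at most `(a_n - a_1)²`; this is what
the denominator in `I_f` is chosen for. -/
theorem monotone_iter (ha : StrictMono a) : Monotone (iter a E) := by
  have hd : ∀ t, HasDerivAt (iter a E) _ t := fun t =>
    (hasDerivAt_id t).sub ((hasDerivAt_gap a E t).div_const ((a (Fin.last (m + 1)) - a 0) ^ 2))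
  refine monotone_of_deriv_nonneg (fun t => (hd t).differentiableAt) fun t => ?_
  rw [(hd t).deriv, sub_nonneg, div_le_one (sq_pos_of_pos (spread_pos ha))]
  change average (fun i => (a i - average a (gibbs a t)) ^ 2) (gibbs a t) ≤ _
  refine average_le fun i => ?_
  have h1 := average_le (x := gibbs a t) (le_last ha)
  have h2 := le_average (x := gibbs a t) (zero_le ha)
  have h3 := le_last ha i
  have h4 := zero_le ha i
  exact sq_le_sq' (by linarith) (by linarith)

/-- The mean energy tends to `a_n` at `∞` and to `a_1` at `-∞`; the intermediate value theorem
applies. -/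
theorem exists_gap_eq_zero (ha : StrictMono a) (hE₁ : a 0 < E)
    (hEn : E < a (Fin.last (m + 1))) : ∃ l, gap a E l = 0 := by
  have htop : Tendsto (fun t => (gibbs a t).prob) atTop (𝓝 (pure (Fin.last (m + 1))).prob) :=
    tendsto_gibbs_pure a fun i hi =>
      tendsto_id.atTop_mul_const_of_neg (sub_neg.2 (ha (Fin.lt_last_iff_ne_last.2 hi)))
  have hbot : Tendsto (fun t => (gibbs a t).prob) atBot (𝓝 (pure 0).prob) :=
    tendsto_gibbs_pure a fun i hi =>
      tendsto_id.atBot_mul_const (sub_pos.2 (ha (Fin.pos_iff_ne_zero.2 hi)))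
  have h1 := tendsto_average (a := a) htop
  have h2 := tendsto_average (a := a) hbot
  rw [average_pure] at h1 h2
  obtain ⟨t1, ht1⟩ := (h1.eventually_const_lt hEn).exists
  obtain ⟨t2, ht2⟩ := (h2.eventually_lt_const hE₁).exists
  exact mem_range_of_exists_le_of_exists_ge (continuous_gap a E)
    ⟨t2, by rw [gap_eq_average]; linarith⟩ ⟨t1, by rw [gap_eq_average]; linarith⟩

theorem iter_eq_self_iff (ha : StrictMono a) (t : ℝ) : iter a E t = t ↔ gap a E t = 0 := by
  rw [iter, sub_eq_self, div_eq_zero_iff]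
  simp [(spread_pos ha).ne']

/-- The iterates of `I_f` from `0` converge to the zero of `f`. -/
theorem tendsto_iterate_iter (ha : StrictMono a) {l : ℝ} (hl : gap a E l = 0) :
    Tendsto (fun k => (iter a E)^[k] 0) atTop (𝓝 l) := by
  have hmono := monotone_iter (E := E) ha
  have hfix : iter a E l = l := (iter_eq_self_iff ha l).2 hl
  have hlim : ∀ L, Tendsto (fun k => (iter a E)^[k] 0) atTop (𝓝 L) → L = l := by
    intro L hL
    have h1 : iter a E L = L := isFixedPt_of_tendsto_iterate hL (continuous_iter a E).continuousAt
    exact (strictMono_gap ha).injective (((iter_eq_self_iff ha L).1 h1).trans hl.symm)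
  have hfixk : ∀ k, (iter a E)^[k] l = l := fun k => Function.iterate_fixed hfix k
  -- The sign of `f(0)` makes the first step go towards `l`. Monotonicity of `I_f` then keeps the
  -- iterates moving that way without passing `l`.
  rcases le_total 0 l with h0 | h0
  · have hup : 0 ≤ iter a E 0 := by
      have := (strictMono_gap (E := E) ha).monotone h0
      rw [hl] at this
      have := div_nonpos_of_nonpos_of_nonneg this (sq_nonneg (a (Fin.last (m + 1)) - a 0))
      rw [iter]
      linarith
    have hm := hmono.monotone_iterate_of_le_map hup
    have hb : BddAbove (Set.range fun k => (iter a E)^[k] 0) :=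
      ⟨l, by
        rintro _ ⟨k, rfl⟩
        exact (hmono.iterate k h0).trans (hfixk k).le⟩
    have h := tendsto_atTop_ciSup hm hb
    rwa [hlim _ h] at h
  · have hdown : iter a E 0 ≤ 0 := by
      have := (strictMono_gap (E := E) ha).monotone h0
      rw [hl] at this
      have := div_nonneg this (sq_nonneg (a (Fin.last (m + 1)) - a 0))
      rw [iter]
      linarith
    have hm := hmono.antitone_iterate_of_map_le hdown
    have hb : BddBelow (Set.range fun k => (iter a E)^[k] 0) :=
      ⟨l, by
        rintro _ ⟨k, rfl⟩
        exact (hfixk k).ge.trans (hmono.iterate k h0)⟩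
    have h := tendsto_atTop_ciInf hm hb
    rwa [hlim _ h] at h

/-! ### Maximum entropy -/

/-- A Gibbs state has a larger entropy than every other state with the same average energy. -/
theorem entropy_lt_of_ne {l : ℝ} {x : ClassicalState (m + 2)}
    (hx : average a x = average a (gibbs a l)) (hne : x ≠ gibbs a l) :
    entropy x < entropy (gibbs a l) := by
  have hlog : ∀ i, Real.log ((gibbs a l).prob i) = l * a i - Real.log (∑ j, Real.exp (l * a j)) := by
    intro i
    change Real.log (_ / _) = _
    rw [Real.log_div (Real.exp_pos _).ne' (partition_pos a l).ne', Real.log_exp]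
  -- The logarithm of a Gibbs weight is affine in the energy, so this sum depends on `z` only
  -- through its average.
  have hcross : ∀ z : ClassicalState (m + 2), ∑ i, z.prob i * Real.log ((gibbs a l).prob i) =
      l * average a z - Real.log (∑ j, Real.exp (l * a j)) := by
    intro z
    have : ∀ i, z.prob i * Real.log ((gibbs a l).prob i) =
        l * (a i * z.prob i) - Real.log (∑ j, Real.exp (l * a j)) * z.prob i := by
      intro i
      rw [hlog]
      ring
    rw [Finset.sum_congr rfl fun i _ => this i, Finset.sum_sub_distrib, ← Finset.mul_sum,
      ← Finset.mul_sum, z.sum_eq, mul_one, average]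
  -- This is `log u < u - 1` at the ratio `u` of the two weights; where `x` vanishes it is
  -- positivity of the Gibbs weight.
  have hpt : ∀ i, x.prob i ≠ (gibbs a l).prob i →
      x.prob i * Real.log ((gibbs a l).prob i) - x.prob i * Real.log (x.prob i) <
        (gibbs a l).prob i - x.prob i := by
    intro i hi
    have hg := gibbs_pos a l i
    rcases (x.nonneg i).eq_or_lt with h0 | h0
    · rw [← h0]
      simpa using hg
    · have h1 : (gibbs a l).prob i / x.prob i ≠ 1 := fun h =>
        hi ((div_eq_one_iff_eq h0.ne').1 h).symm
      have h2 := mul_lt_mul_of_pos_left (Real.log_lt_sub_one_of_pos (div_pos hg h0) h1) h0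
      rwa [Real.log_div hg.ne' h0.ne', mul_sub, mul_sub, mul_div_cancel₀ _ h0.ne', mul_one] at h2
  have hlt : ∑ i, (x.prob i * Real.log ((gibbs a l).prob i) - x.prob i * Real.log (x.prob i)) <
      ∑ i, ((gibbs a l).prob i - x.prob i) := by
    refine Finset.sum_lt_sum (fun i _ => ?_) ?_
    · by_cases h : x.prob i = (gibbs a l).prob i
      · rw [h, sub_self, sub_self]
      · exact (hpt i h).le
    · by_contra! h
      refine hne (ClassicalState.ext (funext fun i => ?_))
      by_contra hi
      exact absurd (hpt i hi) (h i (Finset.mem_univ i)).not_gt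
  rw [Finset.sum_sub_distrib, Finset.sum_sub_distrib, x.sum_eq, (gibbs a l).sum_eq, sub_self,
    hcross, hx, ← hcross] at hlt
  simp only [entropy]
  linarith

theorem isMaxEntropy_iff {l : ℝ} (hl : gap a E l = 0) (y : ClassicalState (m + 2)) :
    IsMaxEntropy a E y ↔ y = gibbs a l := by
  rw [gap_eq_average, sub_eq_zero] at hl
  constructor
  · rintro ⟨h1, h2⟩
    by_contra hne
    exact absurd (entropy_lt_of_ne (h1.trans hl.symm) hne) (h2 _ hl).not_gt
  · rintro rfl
    refine ⟨hl, fun x hx => ?_⟩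
    by_cases hne : x = gibbs a l
    · rw [hne]
    · exact (entropy_lt_of_ne (hx.trans hl.symm) hne).le

end Gibbs

/-! ### The action of `phi` on Gibbs states -/

variable {a : Fin (m + 2) → ℝ} {E : ℝ}

/-- A nonnegative product with `c` expresses lying on the side of `c`, which lets both signs of
`I_f(0)` be treated together. -/
theorem mul_nonneg_of_mul_mul {c p q : ℝ} (hc : c ≠ 0) (hp : 0 ≤ c * p) (hq : 0 ≤ c * q) :
    0 ≤ p * q := by
  rcases hc.lt_or_gt with h | h
  · exact mul_nonneg_of_nonpos_of_nonpos (nonpos_of_mul_nonneg_right hp h)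
      (nonpos_of_mul_nonneg_right hq h)
  · exact mul_nonneg (nonneg_of_mul_nonneg_right hp h) (nonneg_of_mul_nonneg_right hq h)

/-- The Gibbs states increase in the Bayesian order as the parameter moves away from `0`. -/
theorem gibbs_le_gibbs {c s t : ℝ} (hc : c ≠ 0) (hs : 0 ≤ c * s) (hst : c * s ≤ c * t) :
    gibbs a s ≤ gibbs a t := by
  have key : ∀ i j, c * a j ≤ c * a i → Compat (gibbs a s).prob (gibbs a t).prob i j := by
    intro i j hij
    have h0 : 0 ≤ c * (a i - a j) := by linarith
    have h1 := mul_nonneg_of_mul_mul hc hs h0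
    have h2 := mul_nonneg_of_mul_mul hc (hs.trans hst) h0
    -- The ratio of coordinates `i` and `j` is `exp (s (a i - a j))`, so its growth from `s` to `t`
    -- is the sign of this product.
    have h3 := mul_nonneg_of_mul_mul hc (show 0 ≤ c * (t - s) by linarith) h0
    refine ⟨?_, ?_, ?_⟩
    · exact div_le_div_of_nonneg_right (Real.exp_le_exp.2 (by linarith)) (partition_pos a s).le
    · exact div_le_div_of_nonneg_right (Real.exp_le_exp.2 (by linarith)) (partition_pos a t).le
    · change Real.exp _ / _ * (Real.exp _ / _) ≤ Real.exp _ / _ * (Real.exp _ / _)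
      rw [div_mul_div_comm, div_mul_div_comm, ← Real.exp_add, ← Real.exp_add]
      exact div_le_div_of_nonneg_right (Real.exp_le_exp.2 (by linarith))
        (mul_pos (partition_pos a s) (partition_pos a t)).le
  refine le_iff_compat.2 fun i j => ?_
  exact (le_total (c * a j) (c * a i)).imp (key i j) (key j i)

/-- The data that `φ` uses: `k` and `k'` are the indices of the two largest coordinates of the Gibbs states
on the side of `0` on which the zero of `f` lies, and `a k - a k'` has the sign of that side. -/
structure Orientation (a : Fin (m + 2) → ℝ) (E : ℝ) (k k' : Fin (m + 2)) : Prop where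
  ne : k ≠ k'
  fst_pos : ∀ i, i ≠ k → 0 < (a k - a k') * (a k - a i)
  snd_nonneg : ∀ i, i ≠ k → 0 ≤ (a k - a k') * (a k' - a i)
  iter_zero : 0 ≤ (a k - a k') * iter a E 0
  phi_of_isPure : ∀ x, x.IsPure → phi a E x = pure k
  phi_of_not_isPure : ∀ x, ¬ x.IsPure →
    phi a E x = gibbs a (iter a E (Real.log (x.sortDesc 0 / x.sortDesc 1) / (a k - a k')))

theorem exists_orientation (ha : StrictMono a) : ∃ k k', Orientation a E k k' := by
  by_cases h : 0 < iter a E 0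
  · have hlt : a (Fin.last m).castSucc < a (Fin.last (m + 1)) := ha (Fin.castSucc_lt_last _)
    refine ⟨Fin.last (m + 1), (Fin.last m).castSucc, (Fin.castSucc_lt_last _).ne', fun i hi => ?_,
      fun i hi => ?_, mul_nonneg (sub_pos.2 hlt).le h.le, fun x hx => ?_, fun x hx => ?_⟩
    · exact mul_pos (sub_pos.2 hlt) (sub_pos.2 (ha (Fin.lt_last_iff_ne_last.2 hi)))
    · refine mul_nonneg (sub_pos.2 hlt).le (sub_nonneg.2 (ha.monotone ?_))
      have := Fin.lt_last_iff_ne_last.2 hi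
      rw [Fin.le_def]
      rw [Fin.lt_def] at this
      simp at this ⊢
      omega
    · simp only [phi, lam, if_pos h, if_pos hx]
      rfl
    · simp only [phi, lam, if_pos h, if_neg hx]
      rfl
  · have hlt : a 0 < a 1 := ha Fin.zero_lt_one
    refine ⟨0, 1, zero_ne_one, fun i hi => ?_, fun i hi => ?_,
      mul_nonneg_of_nonpos_of_nonpos (sub_neg.2 hlt).le (not_lt.1 h), fun x hx => ?_, fun x hx => ?_⟩
    · exact mul_pos_of_neg_of_neg (sub_neg.2 hlt) (sub_neg.2 (ha (Fin.pos_iff_ne_zero.2 hi)))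
    · exact mul_nonneg_of_nonpos_of_nonpos (sub_neg.2 hlt).le
        (sub_nonpos.2 (ha.monotone (Fin.one_le_of_ne_zero hi)))
    · simp only [phi, lam, if_neg h, if_pos hx]
      rfl
    · simp only [phi, lam, if_neg h, if_neg hx]
      rfl

namespace Orientation

variable {k k' : Fin (m + 2)} (o : Orientation a E k k')

include o

theorem sub_ne_zero : a k - a k' ≠ 0 := by
  intro h
  have := o.fst_pos k' o.ne.symm
  rw [h, zero_mul] at this
  exact this.false

theorem isTopPair_gibbs {t : ℝ} (ht : 0 ≤ (a k - a k') * t) :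
    IsTopPair (gibbs a t).prob k k' := by
  refine ⟨o.ne, fun i => ?_, fun i hi => ?_⟩ <;>
    refine div_le_div_of_nonneg_right (Real.exp_le_exp.2 ?_) (partition_pos a t).le
  · by_cases hi : i = k
    · rw [hi]
    · have := mul_nonneg_of_mul_mul o.sub_ne_zero ht (o.fst_pos i hi).le
      linarith
  · have := mul_nonneg_of_mul_mul o.sub_ne_zero ht (o.snd_nonneg i hi)
    linarith

/-- Conjugating `I_f` by the factor `a k - a k'` gives an increasing map whatever the sign of the
factor. -/
theorem mul_iter_div_mono (ha : StrictMono a) {u v : ℝ} (h : u ≤ v) :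
    (a k - a k') * iter a E (u / (a k - a k')) ≤ (a k - a k') * iter a E (v / (a k - a k')) := by
  rcases o.sub_ne_zero.lt_or_gt with hc | hc
  · exact mul_le_mul_of_nonpos_left (monotone_iter ha (div_le_div_of_nonpos_of_le hc.le h)) hc.le
  · exact mul_le_mul_of_nonneg_left (monotone_iter ha (div_le_div_of_nonneg_right h hc.le)) hc.le

theorem mul_iter_div_nonneg (ha : StrictMono a) {u : ℝ} (h : 0 ≤ u) :
    0 ≤ (a k - a k') * iter a E (u / (a k - a k')) := by
  have := o.mul_iter_div_mono ha h
  rw [zero_div] at this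
  exact o.iter_zero.trans this

theorem mul_iter_nonneg (ha : StrictMono a) {t : ℝ} (ht : 0 ≤ (a k - a k') * t) :
    0 ≤ (a k - a k') * iter a E t := by
  have := o.mul_iter_div_nonneg ha ht
  rwa [mul_div_cancel_left₀ _ o.sub_ne_zero] at this

/-- The two largest coordinates have ratio `exp (t (a k - a k'))`, whose logarithm divided by `a k -
a k'` is `t`. -/
theorem phi_gibbs {t : ℝ} (ht : 0 ≤ (a k - a k') * t) :
    phi a E (gibbs a t) = gibbs a (iter a E t) := by
  have hp := o.isTopPair_gibbs ht
  have hn : ¬ (gibbs a t).IsPure := fun h => (gibbs_pos a t k').ne' (hp.isPure_iff.1 h)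
  rw [o.phi_of_not_isPure _ hn, hp.sortDesc_zero, hp.sortDesc_one]
  change gibbs a (iter a E (Real.log (_ / _ / (_ / _)) / _)) = _
  rw [div_div_div_cancel_right₀ (partition_pos a t).ne', ← Real.exp_sub, Real.log_exp, ← mul_sub,
    mul_div_cancel_right₀ _ o.sub_ne_zero]

theorem phi_iterate_bot (ha : StrictMono a) (r : ℕ) :
    0 ≤ (a k - a k') * (iter a E)^[r] 0 ∧
      (phi a E)^[r] ⊥ = gibbs a ((iter a E)^[r] 0) := by
  induction r with
  | zero =>
    refine ⟨by simp, ?_⟩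
    change uniform (m + 1) = gibbs a 0
    ext i
    simp [uniform, gibbs]
    ring
  | succ r ih =>
    rw [Function.iterate_succ_apply', Function.iterate_succ_apply', ih.2]
    exact ⟨o.mul_iter_nonneg ha ih.1, o.phi_gibbs ih.1⟩

theorem gibbs_le_pure {t : ℝ} (ht : 0 ≤ (a k - a k') * t) : gibbs a t ≤ pure k := by
  refine le_iff_compat.2 fun i j => ?_
  have htop := (o.isTopPair_gibbs ht).le_fst
  have hk : ∀ i, Compat (gibbs a t).prob (pure k).prob k i := by
    intro i
    by_cases hi : i = k
    · subst hi
      exact ⟨le_rfl, le_rfl, le_rfl⟩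
    · refine ⟨htop i, ?_, ?_⟩
      · simp [pure, hi]
      · simpa [pure, hi] using (gibbs_pos a t i).le
  by_cases hi : i = k
  · exact Or.inl (hi ▸ hk j)
  by_cases hj : j = k
  · exact Or.inr (hj ▸ hk i)
  rcases le_total ((gibbs a t).prob j) ((gibbs a t).prob i) with h | h
  · exact Or.inl ⟨h, by simp [pure, hi, hj], by simp [pure, hi, hj]⟩
  · exact Or.inr ⟨h, by simp [pure, hi, hj], by simp [pure, hi, hj]⟩

/-! ### Monotonicity and Scott continuity of `phi` -/

theorem monotone_phi (ha : StrictMono a) : Monotone (phi a E) := by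
  intro x y h
  obtain ⟨i, j, hx, hy, hxy⟩ := exists_isTopPair_of_le h
  by_cases hyp : y.IsPure
  · rw [o.phi_of_isPure y hyp]
    by_cases hxp : x.IsPure
    · rw [o.phi_of_isPure x hxp]
    · rw [o.phi_of_not_isPure x hxp, hx.sortDesc_zero, hx.sortDesc_one]
      exact o.gibbs_le_pure (o.mul_iter_div_nonneg ha (Real.log_nonneg (hx.one_le_div hxp)))
  · have hxp : ¬ x.IsPure := fun hxp => hyp ((hxp.mono h).symm ▸ hxp)
    rw [o.phi_of_not_isPure y hyp, o.phi_of_not_isPure x hxp, hx.sortDesc_zero, hx.sortDesc_one,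
      hy.sortDesc_zero, hy.sortDesc_one]
    have h1 := hx.one_le_div hxp
    have h2 : x.prob i / x.prob j ≤ y.prob i / y.prob j := by
      rw [div_le_div_iff₀ (hx.snd_pos hxp) (hy.snd_pos hyp)]
      linarith
    exact gibbs_le_gibbs o.sub_ne_zero (o.mul_iter_div_nonneg ha (Real.log_nonneg h1))
      (o.mul_iter_div_mono ha (Real.log_le_log (zero_lt_one.trans_le h1) h2))

theorem tendsto_gibbs_iter_pure (ha : StrictMono a) {ι : Type*} {F : Filter ι} {u : ι → ℝ}
    (hu : Tendsto u F atTop) :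
    Tendsto (fun t => (gibbs a (iter a E (u t / (a k - a k')))).prob) F (𝓝 (pure k).prob) := by
  refine tendsto_gibbs_pure a fun i hi => ?_
  set c := a k - a k'
  have hc : 0 < c ^ 2 := sq_pos_of_ne_zero o.sub_ne_zero
  have h1 : Tendsto (fun t => c * iter a E (u t / c)) F atTop := by
    -- Since `f` is bounded, `c I_f(u / c)` differs from `u` by at most the constant `B`.
    set B := |c| * ((|a 0| + |a (Fin.last (m + 1))| + |E|) /
      (a (Fin.last (m + 1)) - a 0) ^ 2) with hB
    refine tendsto_atTop_mono (fun t => ?_) (tendsto_atTop_add_const_right F (-B) hu)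
    have hg : |gap a E (u t / c)| ≤ |a 0| + |a (Fin.last (m + 1))| + |E| := by
      rw [gap_eq_average]
      have h1 := average_le (x := gibbs a (u t / c)) (le_last ha)
      have h2 := le_average (x := gibbs a (u t / c)) (zero_le ha)
      have h3 := abs_le.1 (le_refl |a 0|)
      have h4 := abs_le.1 (le_refl |a (Fin.last (m + 1))|)
      have h5 := abs_le.1 (le_refl |E|)
      refine abs_le.2 ⟨?_, ?_⟩ <;> linarith [h3.1, h3.2, h4.1, h4.2, h5.1, h5.2]
    have hle : c * (gap a E (u t / c) / (a (Fin.last (m + 1)) - a 0) ^ 2) ≤ B := by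
      refine (le_abs_self _).trans ?_
      rw [abs_mul, abs_div, abs_of_pos (sq_pos_of_pos (spread_pos ha))]
      exact mul_le_mul_of_nonneg_left (div_le_div_of_nonneg_right hg (sq_nonneg _)) (abs_nonneg c)
    rw [iter, mul_sub, mul_div_cancel₀ _ o.sub_ne_zero]
    linarith
  have h2 := h1.atTop_mul_const_of_neg
    (show c * (a i - a k) / c ^ 2 < 0 from div_neg_of_neg_of_pos (by linarith [o.fst_pos i hi]) hc)
  refine h2.congr fun t => ?_
  have := o.sub_ne_zero
  change c ≠ 0 at this
  field_simp

theorem scottContinuous_phi (ha : StrictMono a) : ScottContinuous (phi a E) := by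
  intro D hne hD y hy
  refine ⟨(o.monotone_phi ha).mem_upperBounds_image hy.1, fun w hw => ?_⟩
  have hw' : ∀ d ∈ D, phi a E d ≤ w := fun d hd => hw (Set.mem_image_of_mem _ hd)
  -- Pure states are maximal, so a pure element of `D` is already its supremum.
  by_cases hp : ∃ d ∈ D, d.IsPure
  · obtain ⟨d, hd, hdp⟩ := hp
    rw [hdp.mono (hy.1 hd)]
    exact hw' d hd
  push Not at hp
  obtain ⟨U, hU⟩ := exists_ultrafilter_tendsto hne hD hy
  obtain ⟨i, j, hev, hij⟩ := exists_eventually_isTopPair U hU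
  have hi := tendsto_pi_nhds.1 hU i
  have hj := tendsto_pi_nhds.1 hU j
  have hphi : ∀ᶠ d : D in (U : Filter D), (gibbs a (iter a E
      (Real.log (d.1.prob i / d.1.prob j) / (a k - a k')))).prob = (phi a E d.1).prob := by
    filter_upwards [hev] with d hd
    rw [o.phi_of_not_isPure _ (hp d.1 d.2), hd.sortDesc_zero, hd.sortDesc_one]
  have hlim : Tendsto (fun d : D => (phi a E d.1).prob) U (𝓝 (phi a E y).prob) := by
    refine Tendsto.congr' hphi ?_
    -- At a pure limit the second coordinate of the top pair tends to `0` from above while the first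
    -- stays away from `0`, so the logarithm of their ratio tends to `∞`.
    by_cases hyp : y.IsPure
    · rw [o.phi_of_isPure y hyp]
      refine o.tendsto_gibbs_iter_pure ha (Real.tendsto_log_atTop.comp ?_)
      have hj0 : Tendsto (fun d : D => d.1.prob j) U (𝓝[>] 0) := by
        refine tendsto_nhdsWithin_iff.2 ⟨hij.isPure_iff.1 hyp ▸ hj, ?_⟩
        filter_upwards [hev] with d hd using hd.snd_pos (hp d.1 d.2)
      have hipos : 0 < y.prob i := by
        obtain ⟨l, hl⟩ := hyp
        linarith [hij.le_fst l]
      simpa only [div_eq_mul_inv, Function.comp_def] using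
        hi.pos_mul_atTop hipos (tendsto_inv_nhdsGT_zero.comp hj0)
    · rw [o.phi_of_not_isPure y hyp, hij.sortDesc_zero, hij.sortDesc_one]
      have hratio := (hi.div hj (hij.snd_pos hyp).ne').log
        (zero_lt_one.trans_le (hij.one_le_div hyp)).ne'
      exact ((continuous_gibbs_prob a).comp (continuous_iter a E)).continuousAt.tendsto.comp
        (hratio.div_const _)
  exact le_of_tendsto_prob hlim tendsto_const_nhds
    (Eventually.of_forall fun d : D => hw' d.1 d.2)

/-! ### The least fixed point -/

theorem isLUB_iterate (ha : StrictMono a) {l : ℝ} (hl : gap a E l = 0) :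
    0 ≤ (a k - a k') * l ∧
      IsLUB (Set.range fun r : ℕ => (phi a E)^[r] ⊥) (gibbs a l) := by
  have hlim := tendsto_iterate_iter ha hl
  have hnn : 0 ≤ (a k - a k') * l :=
    ge_of_tendsto' (hlim.const_mul _) fun r => (o.phi_iterate_bot ha r).1
  have hmono := (o.monotone_phi ha).monotone_iterate_of_le_map (bot_le (a := phi a E ⊥))
  have hprob : Tendsto (fun r : ℕ => ((phi a E)^[r] ⊥).prob) atTop (𝓝 (gibbs a l).prob) := by
    simp only [(o.phi_iterate_bot ha _).2]
    exact (continuous_gibbs_prob a).continuousAt.tendsto.comp hlim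
  refine ⟨hnn, ?_, fun w hw => ?_⟩
  · rintro _ ⟨r, rfl⟩
    exact le_of_tendsto_prob tendsto_const_nhds hprob
      ((eventually_ge_atTop r).mono fun s hs => hmono hs)
  · exact le_of_tendsto_prob hprob tendsto_const_nhds
      (Eventually.of_forall fun r => hw (Set.mem_range_self r))

/-- Kleene's argument: a fixed point lies above `⊥`, hence above every iterate of `⊥` and above
their supremum. That this supremum is fixed is read off from `I_f(l) = l`. -/
theorem isLeast_fixedPoints (ha : StrictMono a) {l : ℝ} (hl : gap a E l = 0) :
    IsLeast (Function.fixedPoints (phi a E)) (gibbs a l) := by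
  obtain ⟨hnn, hlub⟩ := o.isLUB_iterate ha hl
  refine ⟨?_, fun x hx => hlub.2 ?_⟩
  · change phi a E (gibbs a l) = gibbs a l
    rw [o.phi_gibbs hnn, (iter_eq_self_iff ha l).2 hl]
  · rintro _ ⟨r, rfl⟩
    have h := (o.monotone_phi ha).iterate r (bot_le (a := x))
    rwa [Function.iterate_fixed hx] at h

end Orientation

end ClassicalState

theorem mainTheorem1 (m : ℕ) (a : Fin (m + 2) → ℝ) (ha : StrictMono a) (E : ℝ)
    (hE₁ : a 0 < E) (hEn : E < a (Fin.last (m + 1))) :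
    ScottContinuous (ClassicalState.phi a E) ∧
      ∃ l : ℝ,
        (∀ t : ℝ, E * ∑ i, Real.exp (t * a i) = ∑ i, a i * Real.exp (t * a i) ↔ t = l) ∧
        (∀ y : ClassicalState (m + 2),
          ClassicalState.IsMaxEntropy a E y ↔ y = ClassicalState.gibbs a l) ∧
        IsLeast (Function.fixedPoints (ClassicalState.phi a E)) (ClassicalState.gibbs a l) ∧
        IsLUB (Set.range fun k : ℕ => (ClassicalState.phi a E)^[k] ⊥)
          (ClassicalState.gibbs a l) := by
  obtain ⟨k, k', o⟩ := ClassicalState.exists_orientation (E := E) ha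
  obtain ⟨l, hl⟩ := ClassicalState.exists_gap_eq_zero ha hE₁ hEn
  refine ⟨o.scottContinuous_phi ha, l, fun t => ?_, ClassicalState.isMaxEntropy_iff hl,
    o.isLeast_fixedPoints ha hl, (o.isLUB_iterate ha hl).2⟩
  rw [← ClassicalState.gap_eq_zero_iff, ← hl]
  exact (ClassicalState.strictMono_gap ha).injective.eq_iff
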